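/- Let $\mathcal X,\mathcal Y,\mathcal Z$ be finite alphabets, $\mathcal X\neq\emptyset$. Consider a discrete memoryless channel with law $p(y|x)$, so that $p(y_i|x^i,y^{i-1})=p(y_i|x_i)$ for all $i$, and a noisy feedback link $\{p(z_i|y^i,z^{i-1})\}_{i\ge1}$. An $(M,n)$ code consists of encoding maps $x_i=f_i(w,z^{i-1})$, $1\le i\le n$, $w\in\{1,\dots,M\}$ (the encoder sees the message and the past outputs of the feedback link), and a decoder $\mathcal Y^n\to\{1,\dots,M\}$. A rate $R\ge0$ is achievable if there are $(2^{\lfloor nR\rfloor},n)$ codes, $n\in\mathbb N$, whose maximal probability of error tends to $0$. The noisy-feedback capacity $C_{FB}^{noise}$ is the supremum of the achievable rates; the non-feedback capacity is the same supremum over codes whose encoding maps depend only on $w$. An encoder is a sequence of $(M_n,n)$ codes, $n\in\mathbb N$, with the message uniform on $\{1,\dots,M_n\}$. It achieves the rate $R$ if its maximal probability of error tends to $0$ and $\liminf_n\frac1n\log_2M_n\ge R$. For the $n$-th code let $$I(Z^{n-1}\to Y^n)=\mathbb E\,\log_2\frac{\prod_{i=1}^np(Y_i|Y^{i-1},Z^{i-1})}{p(Y^n)}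 .$$ The encoder is called a typical closed-loop encoder if $\liminf_{n}\frac1nI(Z^{n-1}\to Y^n)>0$. Then: 1. $C_{FB}^{noise}$ equals the non-feedback capacity, and both equal $C=\max_{p(x)}I(X;Y)$ (in bits; the maximum is attained). 2. No typical closed-loop encoder achieves the rate $C$; equivalently, every encoder that achieves the rate $C$ is not a typical closed-loop encoder. 3. Every rate $R$ achieved by a typical closed-loop encoder satisfies $$R\le C-\liminf_{n\to\infty}\frac1nI(Z^{n-1}\to Y^n).$$ -/

import Mathlib

open Filter Topology

noncomputable section

namespace NoisyFeedback

/-- A transition law `p(b | a)` between finite alphabets. -/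
structure Transition (A B : Type*) [Fintype B] where
  prob : A → B → ℝ
  nonneg : ∀ a b, 0 ≤ prob a b
  sum_eq_one : ∀ a, ∑ b, prob a b = 1

/-- A discrete memoryless channel: at every time `p(y_i | x^i, y^{i-1}) = p(y_i | x_i)`. -/
abbrev DMC (X Y : Type*) [Fintype Y] := Transition X Y

/-- A feedback link `p(z_i | y^i, z^{i-1})`. Times are counted from `0`: at index `i` the link has
seen `i + 1` channel outputs and has produced `i` symbols before. -/
abbrev FeedbackLink (Y Z : Type*) [Fintype Z] :=
  (i : ℕ) → Transition ((Fin (i + 1) → Y) × (Fin i → Z)) Z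

/-- The probability of the event `E` under the mass function `μ`. -/
def Pr {Ω : Type*} [Fintype Ω] (μ : Ω → ℝ) (E : Set Ω) : ℝ := ∑ ω, E.indicator μ ω

/-- The mutual information (in bits) of a joint mass function `r` on `A × B`. -/
def mutualInfo {A B : Type*} [Fintype A] [Fintype B] (r : A × B → ℝ) : ℝ :=
  ∑ ω, r ω * Real.logb 2 (r ω / ((∑ b, r (ω.1, b)) * ∑ a, r (a, ω.2)))

/-- The values `I(X;Y)`, over all input distributions `p(x)`. -/
def mutualInfoValues {X Y : Type*} [Fintype X] [Fintype Y] (W : DMC X Y) : Set ℝ :=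
  (fun p : X → ℝ => mutualInfo (fun ω : X × Y => p ω.1 * W.prob ω.1 ω.2)) '' stdSimplex ℝ X

/-- The number `C = max_{p(x)} I(X;Y)`. -/
def maxMutualInfo {X Y : Type*} [Fintype X] [Fintype Y] (W : DMC X Y) : ℝ :=
  sSup (mutualInfoValues W)

/-- An `(M, n)` code for a channel with feedback. The `i`-th channel input is a function of the
message and of the feedback symbols received strictly before; the decoder sees all outputs. -/
structure Code (X Y Z : Type*) (n M : ℕ) where
  enc : Fin M → (i : Fin n) → (Fin i → Z) → X
  dec : (Fin n → Y) → Fin M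

section Codes

variable {X Y Z : Type*} [Fintype Y] [Fintype Z] {n M : ℕ}

/-- The law of `(Y^n, Z^n)` given that the message is `w`. -/
def condLaw (W : DMC X Y) (q : FeedbackLink Y Z) (c : Code X Y Z n M) (w : Fin M) :
    (Fin n → Y) × (Fin n → Z) → ℝ := fun ω =>
  ∏ i : Fin n,
    W.prob (c.enc w i (Fin.take i i.isLt.le ω.2)) (ω.1 i) *
      (q i).prob (Fin.take (i + 1) i.isLt ω.1, Fin.take i i.isLt.le ω.2) (ω.2 i)

/-- The law of `(Y^n, Z^n)` for a uniformly distributed message. -/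
def outputLaw (W : DMC X Y) (q : FeedbackLink Y Z) (c : Code X Y Z n M) :
    (Fin n → Y) × (Fin n → Z) → ℝ := fun ω =>
  (M : ℝ)⁻¹ * ∑ w, condLaw W q c w ω

/-- The maximal probability of decoding error. -/
def maxError (W : DMC X Y) (q : FeedbackLink Y Z) (c : Code X Y Z n M) : ℝ :=
  ⨆ w : Fin M, Pr (condLaw W q c w) {ω | c.dec ω.1 ≠ w}

/-- The causal conditional probability
`∏_{i=1}^n p(y_i | y^{i-1}, z^{i-1})` of the sequence `y^n` given `z^{n-1}`. -/
def causalCondProb (μ : (Fin n → Y) × (Fin n → Z) → ℝ) (y : Fin n → Y) (z : Fin n → Z) : ℝ :=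
  ∏ i : Fin n,
    Pr μ {ω | Fin.take (i + 1) i.isLt ω.1 = Fin.take (i + 1) i.isLt y ∧
        Fin.take i i.isLt.le ω.2 = Fin.take i i.isLt.le z} /
      Pr μ {ω | Fin.take i i.isLt.le ω.1 = Fin.take i i.isLt.le y ∧
        Fin.take i i.isLt.le ω.2 = Fin.take i i.isLt.le z}

/-- The directed information `I(Z^{n-1} → Y^n)` (in bits), the expectation of
`log (∏_{i=1}^n p(Y_i | Y^{i-1}, Z^{i-1}) / p(Y^n))`. -/
def directedInfo (μ : (Fin n → Y) × (Fin n → Z) → ℝ) : ℝ :=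
  ∑ ω, μ ω * Real.logb 2 (causalCondProb μ ω.1 ω.2 / Pr μ {ω' | ω'.1 = ω.1})

/-- The code does not use the feedback: every channel input depends on the message only. -/
def Code.IsOpenLoop (c : Code X Y Z n M) : Prop :=
  ∀ w i z z', c.enc w i z = c.enc w i z'

end Codes

/-- A sequence of codes, one `(M_n, n)` code for every block length `n`. -/
structure CodeSeq (X Y Z : Type*) where
  size : ℕ → ℕ
  code : (n : ℕ) → Code X Y Z n (size n)

namespace CodeSeq

variable {X Y Z : Type*} [Fintype Y] [Fintype Z]

/-- The maximal probability of error tends to zero. -/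
def Reliable (W : DMC X Y) (q : FeedbackLink Y Z) (c : CodeSeq X Y Z) : Prop :=
  Tendsto (fun n => maxError W q (c.code n)) atTop (𝓝 0)

/-- `liminf_n (log M_n) / n ≥ R`. -/
def AttainsRate (c : CodeSeq X Y Z) (R : ℝ) : Prop :=
  ∀ ε > 0, ∀ᶠ n in atTop, R - ε ≤ Real.logb 2 (c.size n) / n

/-- `liminf_n (1/n) I(Z^{n-1} → Y^n)` for the given encoders. -/
def directedInfoRate (W : DMC X Y) (q : FeedbackLink Y Z) (c : CodeSeq X Y Z) : ℝ :=
  liminf (fun n : ℕ => directedInfo (outputLaw W q (c.code n)) / n) atTop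

/-- The encoders form a typical closed-loop encoder. -/
def IsTypicalClosedLoop (W : DMC X Y) (q : FeedbackLink Y Z) (c : CodeSeq X Y Z) : Prop :=
  0 < c.directedInfoRate W q

/-- No encoder of the sequence uses the feedback. -/
def IsOpenLoop (c : CodeSeq X Y Z) : Prop := ∀ n, (c.code n).IsOpenLoop

end CodeSeq

section Rates

variable {X Y Z : Type*} [Fintype Y] [Fintype Z]

/-- The achievable rates with noisy feedback: there are `(2^{⌊nR⌋}, n)` codes whose maximal
probability of error tends to zero. -/
def feedbackRates (W : DMC X Y) (q : FeedbackLink Y Z) : Set ℝ :=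
  {R | 0 ≤ R ∧ ∃ c : CodeSeq X Y Z,
    (∀ n : ℕ, c.size n = 2 ^ ⌊(n : ℝ) * R⌋₊) ∧ c.Reliable W q}

/-- The achievable rates without feedback. -/
def openLoopRates (W : DMC X Y) (q : FeedbackLink Y Z) : Set ℝ :=
  {R | 0 ≤ R ∧ ∃ c : CodeSeq X Y Z,
    (∀ n : ℕ, c.size n = 2 ^ ⌊(n : ℝ) * R⌋₊) ∧ c.IsOpenLoop ∧ c.Reliable W q}

end Rates

end NoisyFeedback

end

noncomputable section

namespace NoisyFeedback

/-! The converse rests on one cancellation. Given the message, the law of (Y^n, Z^n) is a channel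
factor `chanProb` times a link factor `linkProb`, and the link never sees the message. Averaging
over messages therefore leaves the link factor intact: where it is positive, `outputLaw` is the
causal conditional probability times the same `linkProb`. In the information density between the
message W and (Y^n, Z^n) the link cancels, whence I(W; Y^n, Z^n) + I(Z^{n-1} → Y^n) = E log
(`chanProb` / p(Y^n)). The right side is at most nC by single-letterisation
(`sum_logb_chanProb_le`), and I(W; Y^n, Z^n) is at least (1 - error) log M - 1 (`fano`). So directed
information is paid for out of the rate (`directedInfo_add_le`); dividing by n gives the rate loss,
and a positive loss excludes the rate C. Since directed information is nonnegative
(`directedInfo_nonneg`), C bounds every rate with feedback.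

Achievability ignores the feedback: `feinstein` chooses codewords greedily, and Chebyshev's
inequality keeps the information density of a random block near nC. Open-loop codes are feedback
codes, so both suprema equal C. -/

/-- The weight of a word generated letter by letter from causal kernels. -/
def seqProb {A : Type*} (κ : (i : ℕ) → (Fin i → A) → A → ℝ) (n : ℕ) (a : Fin n → A) : ℝ :=
  ∏ i : Fin n, κ i (Fin.take i i.isLt.le a) (a i)

/-! ### Words drawn letter by letter from causal kernels -/

section seqProb

variable {A : Type*}

theorem take_snoc {m n : ℕ} (h : m ≤ n) (a : Fin n → A) (x : A) :
    Fin.take m (h.trans n.le_succ) (Fin.snoc a x : Fin (n + 1) → A) = Fin.take m h a := by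
  funext j
  have : Fin.castLE (h.trans n.le_succ) j = Fin.castSucc (Fin.castLE h j) := rfl
  simp only [Fin.take_apply]
  rw [this, Fin.snoc_castSucc]

theorem take_succ_eq_snoc {i n : ℕ} (h : i < n) (a : Fin n → A) :
    Fin.take (i + 1) h a = Fin.snoc (Fin.take i h.le a) (a ⟨i, h⟩) := by
  funext j
  refine Fin.lastCases ?_ (fun j => ?_) j
  · rw [Fin.snoc_last]; rfl
  · rw [Fin.snoc_castSucc]; rfl

theorem seqProb_snoc (κ : (i : ℕ) → (Fin i → A) → A → ℝ) (n : ℕ) (a : Fin n → A) (x : A) :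
    seqProb κ (n + 1) (Fin.snoc a x) = seqProb κ n a * κ n a x := by
  unfold seqProb
  rw [Fin.prod_univ_castSucc]
  congr 1
  · refine Finset.prod_congr rfl fun i _ => ?_
    rw [Fin.snoc_castSucc]
    congr 1
    exact take_snoc i.isLt.le a x
  · rw [Fin.snoc_last]
    congr 1
    exact take_snoc le_rfl a x

variable [Fintype A]

theorem sum_snoc {n : ℕ} (F : (Fin (n + 1) → A) → ℝ) :
    ∑ a, F a = ∑ a : Fin n → A, ∑ x, F (Fin.snoc a x) := by
  rw [← (Fin.snocEquiv fun _ : Fin (n + 1) => A).sum_comp, Fintype.sum_prod_type, Finset.sum_comm]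
  rfl

/-- The letters after time m sum out one at a time, last first, because each kernel has total mass
one. -/
theorem sum_seqProb_take {κ : (i : ℕ) → (Fin i → A) → A → ℝ} (hκ : ∀ i b, ∑ x, κ i b x = 1)
    {m n : ℕ} (h : m ≤ n) (F : (Fin m → A) → ℝ) :
    ∑ a : Fin n → A, seqProb κ n a * F (Fin.take m h a) = ∑ b, seqProb κ m b * F b := by
  induction n, h using Nat.le_induction with
  | base => rfl
  | succ n h ih =>
    rw [sum_snoc, ← ih]
    refine Finset.sum_congr rfl fun a _ => ?_
    simp_rw [seqProb_snoc, take_snoc h]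
    rw [← Finset.sum_mul, ← Finset.mul_sum, hκ, mul_one]

theorem sum_seqProb {κ : (i : ℕ) → (Fin i → A) → A → ℝ} (hκ : ∀ i b, ∑ x, κ i b x = 1) (n : ℕ) :
    ∑ a, seqProb κ n a = 1 := by
  have := sum_seqProb_take hκ (Nat.zero_le n) fun _ => 1
  simpa [seqProb] using this

/-- The tower property: the letter at time i is replaced by its conditional mean given the past. -/
theorem sum_seqProb_letter {κ : (i : ℕ) → (Fin i → A) → A → ℝ} (hκ : ∀ i b, ∑ x, κ i b x = 1)
    {n : ℕ} (i : Fin n) (G : (Fin i → A) → A → ℝ) :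
    ∑ a : Fin n → A, seqProb κ n a * G (Fin.take i i.isLt.le a) (a i) =
      ∑ a : Fin n → A, seqProb κ n a *
        ∑ x, κ i (Fin.take i i.isLt.le a) x * G (Fin.take i i.isLt.le a) x := by
  rw [sum_seqProb_take hκ i.isLt.le (fun b => ∑ x, κ i b x * G b x)]
  have := sum_seqProb_take hκ (Nat.succ_le_of_lt i.isLt)
    (fun b => G (Fin.take i (Nat.le_succ _) b) (b (Fin.last _)))
  refine Eq.trans ?_ (this.trans ?_)
  · rfl
  · rw [sum_snoc]
    refine Finset.sum_congr rfl fun b _ => ?_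
    rw [Finset.mul_sum]
    refine Finset.sum_congr rfl fun x _ => ?_
    rw [seqProb_snoc, take_snoc le_rfl, Fin.snoc_last, mul_assoc]
    rfl

end seqProb

/-- Gibbs' inequality. -/
theorem gibbs {Ω : Type*} [Fintype Ω] {μ ν : Ω → ℝ} (hμ : ∀ ω, 0 ≤ μ ω) (hν : ∀ ω, 0 ≤ ν ω)
    (hac : ∀ ω, 0 < μ ω → 0 < ν ω) (hsum : ∑ ω, ν ω ≤ ∑ ω, μ ω) :
    0 ≤ ∑ ω, μ ω * Real.logb 2 (μ ω / ν ω) := by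
  -- Pointwise form of log t ≤ t - 1 at t = ν/μ; summing it needs only that ν has no more mass than
  -- μ.
  have key : ∀ ω, (μ ω - ν ω) / Real.log 2 ≤ μ ω * Real.logb 2 (μ ω / ν ω) := by
    intro ω
    have h2 : 0 < Real.log 2 := Real.log_pos one_lt_two
    rw [Real.logb, ← mul_div_assoc]
    refine div_le_div_of_nonneg_right ?_ h2.le
    rcases (hμ ω).eq_or_lt with h | h
    · rw [← h]; simpa using hν ω
    · have hn := hac ω h
      have := Real.log_le_sub_one_of_pos (div_pos hn h)
      rw [← inv_div, Real.log_inv]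
      have h3 := mul_le_mul_of_nonneg_left this h.le
      rw [mul_sub, mul_div_cancel₀ _ h.ne'] at h3
      linarith
  refine le_trans ?_ (Finset.sum_le_sum fun ω _ => key ω)
  rw [← Finset.sum_div, Finset.sum_sub_distrib]
  exact div_nonneg (by linarith) (Real.log_pos one_lt_two).le

/-! ### Mutual information and its maximum over input laws -/

section MutualInfo

variable {X Y : Type*} [Fintype X] [Fintype Y]

theorem mutualInfo_channel (W : DMC X Y) {p : X → ℝ} (hp : ∀ x, 0 ≤ p x) :
    mutualInfo (fun ω : X × Y => p ω.1 * W.prob ω.1 ω.2) =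
      ∑ x, p x * ∑ y, W.prob x y * Real.logb 2 (W.prob x y / ∑ a, p a * W.prob a y) := by
  unfold mutualInfo
  rw [Fintype.sum_prod_type]
  refine Finset.sum_congr rfl fun x _ => ?_
  rw [Finset.mul_sum]
  refine Finset.sum_congr rfl fun y _ => ?_
  simp only [← Finset.mul_sum, W.sum_eq_one, mul_one]
  rcases (hp x).eq_or_lt with h | h
  · simp [← h]
  · rw [mul_assoc, mul_div_mul_left _ _ h.ne']

/-- The entropy form H(A) + H(B) - H(A,B). It serves continuity up to the boundary of the simplex,
since `Real.negMulLog` is continuous at 0 while the quotient inside the logarithm is not controlled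
there. -/
theorem mutualInfo_eq_negMulLog {A B : Type*} [Fintype A] [Fintype B] {r : A × B → ℝ}
    (hr : ∀ ω, 0 ≤ r ω) :
    mutualInfo r = (∑ a, Real.negMulLog (∑ b, r (a, b)) + ∑ b, Real.negMulLog (∑ a, r (a, b)) -
      ∑ ω, Real.negMulLog (r ω)) / Real.log 2 := by
  have key : ∀ ω, r ω * Real.logb 2 (r ω / ((∑ b, r (ω.1, b)) * ∑ a, r (a, ω.2))) =
      (r ω * Real.log (r ω) - r ω * Real.log (∑ b, r (ω.1, b)) -
        r ω * Real.log (∑ a, r (a, ω.2))) / Real.log 2 := by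
    intro ω
    rcases (hr ω).eq_or_lt with h | h
    · simp [← h]
    · have h1 : 0 < ∑ b, r (ω.1, b) :=
        h.trans_le (Finset.single_le_sum (f := fun b => r (ω.1, b)) (fun b _ => hr _)
          (Finset.mem_univ ω.2))
      have h2 : 0 < ∑ a, r (a, ω.2) :=
        h.trans_le (Finset.single_le_sum (f := fun a => r (a, ω.2)) (fun b _ => hr _)
          (Finset.mem_univ ω.1))
      rw [Real.logb, Real.log_div h.ne' (mul_pos h1 h2).ne', Real.log_mul h1.ne' h2.ne']
      ring
  unfold mutualInfo
  simp_rw [key]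
  rw [← Finset.sum_div]
  congr 1
  rw [Finset.sum_sub_distrib, Finset.sum_sub_distrib,
    Fintype.sum_prod_type (fun ω : A × B => r ω * Real.log (∑ b, r (ω.1, b))),
    Fintype.sum_prod_type_right (fun ω : A × B => r ω * Real.log (∑ a, r (a, ω.2)))]
  simp_rw [← Finset.sum_mul, Real.negMulLog, neg_mul, Finset.sum_neg_distrib]
  ring

theorem isGreatest_maxMutualInfo [Nonempty X] (W : DMC X Y) :
    IsGreatest (mutualInfoValues W) (maxMutualInfo W) := by
  classical
  have hc : ContinuousOn
      (fun p : X → ℝ => mutualInfo (fun ω : X × Y => p ω.1 * W.prob ω.1 ω.2))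
      (stdSimplex ℝ X) := by
    have : Continuous fun p : X → ℝ =>
        (∑ a, Real.negMulLog (∑ b, p a * W.prob a b) +
          ∑ b, Real.negMulLog (∑ a, p a * W.prob a b) -
          ∑ ω : X × Y, Real.negMulLog (p ω.1 * W.prob ω.1 ω.2)) / Real.log 2 := by
      have := Real.continuous_negMulLog
      fun_prop
    refine this.continuousOn.congr fun p hp => ?_
    exact mutualInfo_eq_negMulLog fun ω => mul_nonneg (hp.1 _) (W.nonneg _ _)
  have hne : (mutualInfoValues W).Nonempty :=
    ⟨_, _, single_mem_stdSimplex ℝ (Classical.arbitrary X), rfl⟩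
  have hcomp : IsCompact (mutualInfoValues W) :=
    (isCompact_stdSimplex (𝕜 := ℝ) X).image_of_continuousOn hc
  exact ⟨hcomp.sSup_mem hne, fun x hx => le_csSup hcomp.bddAbove hx⟩

theorem mutualInfo_le_max [Nonempty X] (W : DMC X Y) {p : X → ℝ} (hp : p ∈ stdSimplex ℝ X) :
    ∑ x, p x * ∑ y, W.prob x y * Real.logb 2 (W.prob x y / ∑ a, p a * W.prob a y) ≤
      maxMutualInfo W := by
  rw [← mutualInfo_channel W hp.1]
  exact (isGreatest_maxMutualInfo W).2 ⟨p, hp, rfl⟩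

end MutualInfo

/-! ### The joint law of outputs and feedback, and its factorisation -/

section Law

variable {X Y Z : Type*} [Fintype Y] [Fintype Z] {n M : ℕ}

/-- The encoding functions for one message, continued beyond the block length. -/
def Code.encExt [Nonempty X] (c : Code X Y Z n M) (w : Fin M) (i : ℕ) (z : Fin i → Z) : X :=
  if h : i < n then c.enc w ⟨i, h⟩ z else Classical.arbitrary X

/-- The conditional law of the next channel output and feedback symbol. -/
def stepKernel (W : DMC X Y) (q : FeedbackLink Y Z) (e : (i : ℕ) → (Fin i → Z) → X) (i : ℕ)
    (b : Fin i → Y × Z) (x : Y × Z) : ℝ :=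
  W.prob (e i fun j => (b j).2) x.1 *
    (q i).prob (Fin.snoc (fun j => (b j).1) x.1, fun j => (b j).2) x.2

theorem sum_stepKernel (W : DMC X Y) (q : FeedbackLink Y Z) (e : (i : ℕ) → (Fin i → Z) → X)
    (i : ℕ) (b : Fin i → Y × Z) : ∑ x, stepKernel W q e i b x = 1 := by
  rw [Fintype.sum_prod_type]
  simp only [stepKernel, ← Finset.mul_sum, Transition.sum_eq_one, mul_one]

/-- With the pairs (y_i, z_i) as letters the law becomes causal. Kernels are indexed by all of ℕ,
hence `Code.encExt`; its values beyond the block never enter. -/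
theorem condLaw_eq_seqProb [Nonempty X] (W : DMC X Y) (q : FeedbackLink Y Z)
    (c : Code X Y Z n M) (w : Fin M) (a : Fin n → Y × Z) :
    condLaw W q c w (fun j => (a j).1, fun j => (a j).2) =
      seqProb (stepKernel W q (c.encExt w)) n a := by
  unfold condLaw seqProb
  refine Finset.prod_congr rfl fun i _ => ?_
  simp only [stepKernel, Code.encExt, i.isLt, dite_true]
  rw [take_succ_eq_snoc i.isLt]
  rfl

theorem sum_pair {F : (Fin n → Y) × (Fin n → Z) → ℝ} :
    ∑ ω, F ω = ∑ a : Fin n → Y × Z, F (fun j => (a j).1, fun j => (a j).2) :=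
  ((Equiv.arrowProdEquivProdArrow (Fin n) (fun _ => Y) fun _ => Z).sum_comp F).symm

theorem condLaw_nonneg (W : DMC X Y) (q : FeedbackLink Y Z) (c : Code X Y Z n M) (w : Fin M)
    (ω : (Fin n → Y) × (Fin n → Z)) : 0 ≤ condLaw W q c w ω :=
  Finset.prod_nonneg fun _ _ => mul_nonneg (Transition.nonneg _ _ _) (Transition.nonneg _ _ _)

theorem outputLaw_nonneg (W : DMC X Y) (q : FeedbackLink Y Z) (c : Code X Y Z n M)
    (ω : (Fin n → Y) × (Fin n → Z)) : 0 ≤ outputLaw W q c ω :=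
  mul_nonneg (by positivity) (Finset.sum_nonneg fun w _ => condLaw_nonneg W q c w ω)

theorem sum_condLaw [Nonempty X] (W : DMC X Y) (q : FeedbackLink Y Z) (c : Code X Y Z n M)
    (w : Fin M) : ∑ ω, condLaw W q c w ω = 1 := by
  rw [sum_pair]
  simp_rw [condLaw_eq_seqProb]
  exact sum_seqProb (sum_stepKernel W q _) n

theorem sum_condLaw_letter [Nonempty X] (W : DMC X Y) (q : FeedbackLink Y Z)
    (c : Code X Y Z n M) (w : Fin M) (i : Fin n) (G : (Fin i → Y) → (Fin i → Z) → Y → Z → ℝ) :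
    ∑ ω, condLaw W q c w ω *
        G (Fin.take i i.isLt.le ω.1) (Fin.take i i.isLt.le ω.2) (ω.1 i) (ω.2 i) =
      ∑ ω, condLaw W q c w ω * ∑ y, W.prob (c.enc w i (Fin.take i i.isLt.le ω.2)) y *
        ∑ z, (q i).prob (Fin.snoc (Fin.take i i.isLt.le ω.1) y, Fin.take i i.isLt.le ω.2) z *
          G (Fin.take i i.isLt.le ω.1) (Fin.take i i.isLt.le ω.2) y z := by
  rw [sum_pair, sum_pair]
  simp_rw [condLaw_eq_seqProb]
  refine (sum_seqProb_letter (sum_stepKernel W q (c.encExt w)) i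
    (fun b x => G (fun j => (b j).1) (fun j => (b j).2) x.1 x.2)).trans ?_
  refine Finset.sum_congr rfl fun a _ => ?_
  congr 1
  rw [Fintype.sum_prod_type]
  refine Finset.sum_congr rfl fun y _ => ?_
  rw [Finset.mul_sum]
  refine Finset.sum_congr rfl fun z _ => ?_
  simp only [stepKernel, Code.encExt, i.isLt, dite_true, mul_assoc]
  rfl

/-- Memorylessness: given the past, the output depends on it only through the current input, even
when that input was chosen from feedback. -/
theorem sum_condLaw_input [Nonempty X] (W : DMC X Y) (q : FeedbackLink Y Z)
    (c : Code X Y Z n M) (w : Fin M) (i : Fin n) (g : X → Y → ℝ) :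
    ∑ ω, condLaw W q c w ω * g (c.enc w i (Fin.take i i.isLt.le ω.2)) (ω.1 i) =
      ∑ ω, condLaw W q c w ω * ∑ y, W.prob (c.enc w i (Fin.take i i.isLt.le ω.2)) y *
        g (c.enc w i (Fin.take i i.isLt.le ω.2)) y := by
  rw [sum_condLaw_letter W q c w i fun _ z y _ => g (c.enc w i z) y]
  simp only [← Finset.sum_mul, Transition.sum_eq_one, one_mul]

theorem Pr_eq_sum_ite {Ω : Type*} [Fintype Ω] (μ : Ω → ℝ) (p : Ω → Prop) [DecidablePred p] :
    Pr μ {ω | p ω} = ∑ ω, μ ω * if p ω then 1 else 0 := by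
  unfold Pr
  refine Finset.sum_congr rfl fun ω _ => ?_
  simp [Set.indicator_apply]

theorem sum_outputLaw_mul (W : DMC X Y) (q : FeedbackLink Y Z) (c : Code X Y Z n M)
    (F : (Fin n → Y) × (Fin n → Z) → ℝ) :
    ∑ ω : (Fin n → Y) × (Fin n → Z), outputLaw W q c ω * F ω =
      ∑ p : Fin M × ((Fin n → Y) × (Fin n → Z)), (M : ℝ)⁻¹ * condLaw W q c p.1 p.2 * F p.2 := by
  refine Eq.trans ?_ (Fintype.sum_prod_type_right _).symm
  refine Finset.sum_congr rfl fun ω _ => ?_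
  simp only [outputLaw, Finset.mul_sum, Finset.sum_mul]

theorem take_eq_take_iff {A : Type*} {m : ℕ} (h : m ≤ n) (a b : Fin n → A) :
    Fin.take m h a = Fin.take m h b ↔ ∀ j : Fin n, (j : ℕ) < m → a j = b j := by
  constructor
  · intro H j hj
    exact congrFun H ⟨j, hj⟩
  · intro H
    funext j
    exact H _ j.isLt

/-- The link kernel does not involve the message, so it survives averaging over messages as the
conditional law of the next feedback symbol. -/
theorem Pr_outputLaw_mul_link [Nonempty X] (W : DMC X Y) (q : FeedbackLink Y Z)
    (c : Code X Y Z n M) (ω : (Fin n → Y) × (Fin n → Z)) (i : Fin n) :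
    Pr (outputLaw W q c) {ω' | Fin.take (i + 1) i.isLt ω'.1 = Fin.take (i + 1) i.isLt ω.1 ∧
        Fin.take i i.isLt.le ω'.2 = Fin.take i i.isLt.le ω.2} *
        (q i).prob (Fin.take (i + 1) i.isLt ω.1, Fin.take i i.isLt.le ω.2) (ω.2 i) =
      Pr (outputLaw W q c) {ω' | Fin.take (i + 1) i.isLt ω'.1 = Fin.take (i + 1) i.isLt ω.1 ∧
        Fin.take (i + 1) i.isLt ω'.2 = Fin.take (i + 1) i.isLt ω.2} := by
  classical
  rw [Pr_eq_sum_ite, Pr_eq_sum_ite, Finset.sum_mul]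
  simp_rw [mul_assoc]
  rw [sum_outputLaw_mul W q c (fun ω' => (if Fin.take (i + 1) i.isLt ω'.1 =
      Fin.take (i + 1) i.isLt ω.1 ∧ Fin.take i i.isLt.le ω'.2 = Fin.take i i.isLt.le ω.2
        then (1 : ℝ) else 0) *
      (q i).prob (Fin.take (i + 1) i.isLt ω.1, Fin.take i i.isLt.le ω.2) (ω.2 i)),
    sum_outputLaw_mul]
  rw [Fintype.sum_prod_type, Fintype.sum_prod_type]
  refine Finset.sum_congr rfl fun w _ => ?_
  simp_rw [mul_assoc]
  rw [← Finset.mul_sum, ← Finset.mul_sum]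
  congr 1
  have hz : ∀ ω' : (Fin n → Y) × (Fin n → Z),
      Fin.take (i + 1) i.isLt ω'.2 = Fin.take (i + 1) i.isLt ω.2 ↔
        Fin.take i i.isLt.le ω'.2 = Fin.take i i.isLt.le ω.2 ∧ ω'.2 i = ω.2 i := by
    intro ω'
    rw [take_eq_take_iff, take_eq_take_iff]
    constructor
    · exact fun H => ⟨fun j hj => H j (by omega), H i (by omega)⟩
    · rintro ⟨H, H'⟩ j hj
      rcases Nat.lt_succ_iff_lt_or_eq.mp hj with h | h
      · exact H j h
      · rw [Fin.ext h]; exact H'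
  simp_rw [hz]
  have hy : ∀ ω' : (Fin n → Y) × (Fin n → Z),
      Fin.take (i + 1) i.isLt ω'.1 = Fin.snoc (Fin.take i i.isLt.le ω'.1) (ω'.1 i) :=
    fun ω' => take_succ_eq_snoc i.isLt ω'.1
  simp_rw [hy]
  rw [← hy ω]
  rw [sum_condLaw_letter W q c w i fun y z η _ =>
    (if (Fin.snoc y η : Fin (i + 1) → Y) = Fin.take (i + 1) i.isLt ω.1 ∧
        z = Fin.take i i.isLt.le ω.2 then 1 else 0) *
      (q i).prob (Fin.take (i + 1) i.isLt ω.1, Fin.take i i.isLt.le ω.2) (ω.2 i)]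
  rw [sum_condLaw_letter W q c w i fun y z η ζ =>
    (if (Fin.snoc y η : Fin (i + 1) → Y) = Fin.take (i + 1) i.isLt ω.1 ∧
        z = Fin.take i i.isLt.le ω.2 ∧ ζ = ω.2 i then 1 else 0)]
  refine Finset.sum_congr rfl fun ω' _ => ?_
  congr 1
  refine Finset.sum_congr rfl fun y _ => ?_
  congr 1
  rw [← Finset.sum_mul, Transition.sum_eq_one, one_mul]
  by_cases h : (Fin.snoc (Fin.take i i.isLt.le ω'.1) y : Fin (i + 1) → Y) =
      Fin.take (i + 1) i.isLt ω.1 ∧ Fin.take i i.isLt.le ω'.2 = Fin.take i i.isLt.le ω.2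
  · simp [h.1, h.2]
  · rw [if_neg h]
    have : ∀ z, ¬ ((Fin.snoc (Fin.take i i.isLt.le ω'.1) y : Fin (i + 1) → Y) =
      Fin.take (i + 1) i.isLt ω.1 ∧ Fin.take i i.isLt.le ω'.2 = Fin.take i i.isLt.le ω.2 ∧
        z = ω.2 i) := fun z hh => h ⟨hh.1, hh.2.1⟩
    simp [this]

/-- The probability of the feedback symbols given the channel outputs,
`∏_{i=1}^n p(z_i | y^i, z^{i-1})`. -/
def linkProb (q : FeedbackLink Y Z) (ω : (Fin n → Y) × (Fin n → Z)) : ℝ :=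
  ∏ i : Fin n, (q i).prob (Fin.take (i + 1) i.isLt ω.1, Fin.take i i.isLt.le ω.2) (ω.2 i)

/-- The probability of the channel outputs given the channel inputs, `∏_{i=1}^n p(y_i | x_i)`. -/
def chanProb (W : DMC X Y) (c : Code X Y Z n M) (w : Fin M)
    (ω : (Fin n → Y) × (Fin n → Z)) : ℝ :=
  ∏ i : Fin n, W.prob (c.enc w i (Fin.take i i.isLt.le ω.2)) (ω.1 i)

theorem condLaw_eq_chanProb_mul_linkProb (W : DMC X Y) (q : FeedbackLink Y Z)
    (c : Code X Y Z n M) (w : Fin M) (ω : (Fin n → Y) × (Fin n → Z)) :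
    condLaw W q c w ω = chanProb W c w ω * linkProb q ω :=
  Finset.prod_mul_distrib

theorem linkProb_nonneg (q : FeedbackLink Y Z) (ω : (Fin n → Y) × (Fin n → Z)) :
    0 ≤ linkProb q ω := Finset.prod_nonneg fun _ _ => Transition.nonneg _ _ _

/-- For fixed outputs the link is a causal kernel in the feedback alone; the outputs are continued
arbitrarily to supply kernels at all times. -/
theorem sum_linkProb [Nonempty Y] (q : FeedbackLink Y Z) (y : Fin n → Y) :
    ∑ z, linkProb q (y, z) = 1 := by
  let y' : ℕ → Y := fun j => if h : j < n then y ⟨j, h⟩ else Classical.arbitrary Y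
  rw [← sum_seqProb (A := Z) (κ := fun i b x => (q i).prob (fun j => y' j, b) x)
    (fun i b => (q i).sum_eq_one _) n]
  refine Finset.sum_congr rfl fun z _ => Finset.prod_congr rfl fun i _ => ?_
  congr 2
  funext j
  have : (j : ℕ) < n := lt_of_lt_of_le j.isLt i.isLt
  simp only [y', this, dite_true]
  rfl

/-- A decoder must return some message, which excludes M = 0. -/
theorem Code.size_pos [Nonempty Y] (c : Code X Y Z n M) : 0 < M :=
  (Nat.zero_le _).trans_lt (c.dec fun _ => Classical.arbitrary Y).isLt

theorem DMC.nonempty_output [Nonempty X] (W : DMC X Y) : Nonempty Y := by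
  by_contra h
  rw [not_nonempty_iff] at h
  simpa using W.sum_eq_one (Classical.arbitrary X)

theorem sum_outputLaw [Nonempty X] (W : DMC X Y) (q : FeedbackLink Y Z) (c : Code X Y Z n M) :
    ∑ ω, outputLaw W q c ω = 1 := by
  have := DMC.nonempty_output W
  have h : (M : ℝ) ≠ 0 := Nat.cast_ne_zero.2 c.size_pos.ne'
  have := sum_outputLaw_mul W q c fun _ => 1
  simp only [mul_one] at this
  rw [this, Fintype.sum_prod_type]
  simp only [← Finset.mul_sum, sum_condLaw]
  simp [h]

theorem sum_inv_mul_condLaw [Nonempty X] (W : DMC X Y) (q : FeedbackLink Y Z)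
    (c : Code X Y Z n M) :
    ∑ p : Fin M × ((Fin n → Y) × (Fin n → Z)), (M : ℝ)⁻¹ * condLaw W q c p.1 p.2 = 1 := by
  have := sum_outputLaw_mul W q c fun _ => 1
  simp only [mul_one] at this
  rw [← this, sum_outputLaw]

theorem prod_div_telescope {n : ℕ} (f : ℕ → ℝ) (hf : ∀ i ≤ n, f i ≠ 0) :
    ∏ i ∈ Finset.range n, f (i + 1) / f i = f n / f 0 := by
  induction n with
  | zero => simp [div_self (hf 0 le_rfl)]
  | succ n ih =>
    rw [Finset.prod_range_succ, ih fun i hi => hf i (hi.trans n.le_succ)]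
    have := hf n n.le_succ
    field_simp

/-- Each causal factor times its link factor is a ratio of consecutive prefix probabilities, and the
product telescopes. Positivity at ω keeps every denominator nonzero. -/
theorem causalCondProb_mul_linkProb [Nonempty X] (W : DMC X Y) (q : FeedbackLink Y Z)
    (c : Code X Y Z n M) {ω : (Fin n → Y) × (Fin n → Z)} (hω : 0 < outputLaw W q c ω) :
    causalCondProb (outputLaw W q c) ω.1 ω.2 * linkProb q ω = outputLaw W q c ω := by
  let B : ℕ → ℝ := fun m => Pr (outputLaw W q c)
    {ω' | ∀ j : Fin n, (j : ℕ) < m → ω'.1 j = ω.1 j ∧ ω'.2 j = ω.2 j}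
  have hset : ∀ (m : ℕ) (h : m ≤ n), {ω' : (Fin n → Y) × (Fin n → Z) |
      Fin.take m h ω'.1 = Fin.take m h ω.1 ∧ Fin.take m h ω'.2 = Fin.take m h ω.2} =
      {ω' | ∀ j : Fin n, (j : ℕ) < m → ω'.1 j = ω.1 j ∧ ω'.2 j = ω.2 j} := by
    intro m h
    ext ω'
    simp only [Set.mem_ofPred_eq, take_eq_take_iff, ← forall_and]
  have hpos : ∀ m, 0 < B m := by
    intro m
    refine hω.trans_le ?_
    have := Finset.single_le_sum (f := fun ω' => Set.indicator
      {ω' | ∀ j : Fin n, (j : ℕ) < m → ω'.1 j = ω.1 j ∧ ω'.2 j = ω.2 j} (outputLaw W q c) ω')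
      (fun ω' _ => Set.indicator_nonneg (fun a _ => outputLaw_nonneg W q c a) _)
      (Finset.mem_univ ω)
    refine le_trans (le_of_eq ?_) this
    exact (Set.indicator_of_mem (by simp) _).symm
  have h0 : B 0 = 1 := by
    simp [B, Pr, sum_outputLaw]
  have hn : B n = outputLaw W q c ω := by
    have : {ω' : (Fin n → Y) × (Fin n → Z) |
        ∀ j : Fin n, (j : ℕ) < n → ω'.1 j = ω.1 j ∧ ω'.2 j = ω.2 j} = {ω} := by
      ext ω'
      simp only [Set.mem_ofPred_eq, Set.mem_singleton_iff, Prod.ext_iff, funext_iff]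
      exact ⟨fun H => ⟨fun j => (H j j.isLt).1, fun j => (H j j.isLt).2⟩,
        fun H j _ => ⟨H.1 j, H.2 j⟩⟩
    classical
    simp only [B, this, Pr, Set.indicator_apply, Set.mem_singleton_iff]
    simp
  have : causalCondProb (outputLaw W q c) ω.1 ω.2 * linkProb q ω =
      ∏ i ∈ Finset.range n, B (i + 1) / B i := by
    rw [Finset.prod_range, causalCondProb, linkProb, ← Finset.prod_mul_distrib]
    refine Finset.prod_congr rfl fun i _ => ?_
    rw [div_mul_eq_mul_div, Pr_outputLaw_mul_link, hset _ i.isLt, hset _ i.isLt.le]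
  rw [this, prod_div_telescope B fun i _ => (hpos i).ne', h0, hn, div_one]

theorem outputLaw_pos (W : DMC X Y) (q : FeedbackLink Y Z) (c : Code X Y Z n M) {w : Fin M}
    {ω : (Fin n → Y) × (Fin n → Z)} (h : 0 < condLaw W q c w ω) : 0 < outputLaw W q c ω := by
  have hM : (0 : ℝ) < M := Nat.cast_pos.2 w.pos
  refine mul_pos (inv_pos.2 hM) (h.trans_le ?_)
  exact Finset.single_le_sum (f := fun w => condLaw W q c w ω)
    (fun w _ => condLaw_nonneg W q c w ω) (Finset.mem_univ w)

theorem Pr_nonneg {Ω : Type*} [Fintype Ω] {μ : Ω → ℝ} (hμ : ∀ ω, 0 ≤ μ ω) (E : Set Ω) :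
    0 ≤ Pr μ E := Finset.sum_nonneg fun _ _ => Set.indicator_nonneg (fun a _ => hμ a) _

theorem Pr_fst_eq (μ : (Fin n → Y) × (Fin n → Z) → ℝ) (y : Fin n → Y) :
    Pr μ {ω | ω.1 = y} = ∑ z, μ (y, z) := by
  classical
  rw [Pr_eq_sum_ite, Fintype.sum_prod_type]
  rw [Finset.sum_eq_single y]
  · simp
  · intro b _ hb
    simp [hb]
  · simp

theorem Pr_fst_pos {μ : (Fin n → Y) × (Fin n → Z) → ℝ} (hμ : ∀ ω, 0 ≤ μ ω)
    {ω : (Fin n → Y) × (Fin n → Z)} (h : 0 < μ ω) : 0 < Pr μ {ω' | ω'.1 = ω.1} := by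
  rw [Pr_fst_eq]
  exact h.trans_le (Finset.single_le_sum (f := fun z => μ (ω.1, z)) (fun z _ => hμ _)
    (Finset.mem_univ ω.2))

/-- Directed information is the divergence of `outputLaw` from p(y) `linkProb`, in which the
feedback is generated from the outputs by the link. -/
theorem directedInfo_nonneg [Nonempty X] (W : DMC X Y) (q : FeedbackLink Y Z)
    (c : Code X Y Z n M) : 0 ≤ directedInfo (outputLaw W q c) := by
  have := DMC.nonempty_output W
  set μ := outputLaw W q c with hμ
  have h0 : ∀ ω, 0 ≤ μ ω := outputLaw_nonneg W q c
  have hl : ∀ ω, 0 < μ ω → 0 < linkProb q ω := by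
    intro ω h
    refine (linkProb_nonneg q ω).lt_of_ne' fun h1 => h.ne' ?_
    rw [hμ, ← causalCondProb_mul_linkProb W q c h, h1, mul_zero]
  refine (gibbs (ν := fun ω => Pr μ {ω' | ω'.1 = ω.1} * linkProb q ω) h0
    (fun ω => mul_nonneg (Pr_nonneg h0 _) (linkProb_nonneg q ω))
    (fun ω h => mul_pos (Pr_fst_pos h0 h) (hl ω h)) ?_).trans_eq ?_
  · rw [Fintype.sum_prod_type]
    simp only [← Finset.mul_sum, sum_linkProb, mul_one, Pr_fst_eq]
    rw [Fintype.sum_prod_type]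
  · refine Finset.sum_congr rfl fun ω _ => ?_
    rcases (h0 ω).eq_or_lt with h | h
    · simp [← h]
    · congr 2
      conv_lhs => rw [hμ, ← causalCondProb_mul_linkProb W q c h]
      rw [mul_div_mul_right _ _ (hl ω h).ne']

end Law

/-! ### The converse for one block -/

section Converse

variable {X Y Z : Type*} [Fintype X] [Fintype Y] [Fintype Z] {n M : ℕ}

theorem Pr_error_le_maxError (W : DMC X Y) (q : FeedbackLink Y Z) (c : Code X Y Z n M)
    (w : Fin M) : Pr (condLaw W q c w) {ω | c.dec ω.1 ≠ w} ≤ maxError W q c :=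
  le_ciSup (f := fun w => Pr (condLaw W q c w) {ω | c.dec ω.1 ≠ w}) (Set.finite_range _).bddAbove w

/-- A Fano type inequality for the information that outputs and feedback carry on the message. -/
theorem fano [Nonempty X] (W : DMC X Y) (q : FeedbackLink Y Z) (c : Code X Y Z n M) :
    (1 - maxError W q c) * Real.logb 2 M - 1 ≤
      ∑ p : Fin M × ((Fin n → Y) × (Fin n → Z)), (M : ℝ)⁻¹ * condLaw W q c p.1 p.2 *
        Real.logb 2 (condLaw W q c p.1 p.2 / outputLaw W q c p.2) := by
  classical
  have := DMC.nonempty_output W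
  have hM : (0 : ℝ) < M := Nat.cast_pos.2 c.size_pos
  have hM1 : (1 : ℝ) ≤ M := Nat.one_le_cast.2 c.size_pos
  let j : Fin M × ((Fin n → Y) × (Fin n → Z)) → ℝ := fun p => (M : ℝ)⁻¹ * condLaw W q c p.1 p.2
  have hj0 : ∀ p, 0 ≤ j p := fun p => mul_nonneg (inv_pos.2 hM).le (condLaw_nonneg _ _ _ _ _)
  have hj1 : ∑ p, j p = 1 := sum_inv_mul_condLaw W q c
  -- The comparison law makes the message uniform and independent of the outputs, then tilts by t/2.
  -- The tilt yields log M exactly on correct decoding; the sum of t over messages is at most 2M, so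
  -- the halving restores total mass at most one and costs the one bit subtracted in the bound.
  let t : Fin M × ((Fin n → Y) × (Fin n → Z)) → ℝ := fun p => if c.dec p.2.1 = p.1 then M else 1
  have ht : ∀ p, 0 < t p := fun p => by simp only [t]; split_ifs <;> linarith
  have htsum : ∀ ω : (Fin n → Y) × (Fin n → Z), ∑ w, t (w, ω) ≤ 2 * M := by
    intro ω
    have : ∀ w, t (w, ω) ≤ (if c.dec ω.1 = w then (M : ℝ) else 0) + 1 := by
      intro w
      simp only [t]
      split_ifs <;> linarith
    refine (Finset.sum_le_sum fun w _ => this w).trans_eq ?_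
    rw [Finset.sum_add_distrib]
    simp
    ring
  have hpos : ∀ p, 0 < j p → 0 < condLaw W q c p.1 p.2 :=
    fun p h => pos_of_mul_pos_right h (inv_pos.2 hM).le
  have hg := gibbs (μ := j) (ν := fun p => (M : ℝ)⁻¹ * outputLaw W q c p.2 * (t p / 2)) hj0
    (fun p => mul_nonneg (mul_nonneg (inv_pos.2 hM).le (outputLaw_nonneg _ _ _ _))
      (by have := ht p; positivity))
    (fun p h => mul_pos (mul_pos (inv_pos.2 hM) (outputLaw_pos W q c (hpos p h)))
      (half_pos (ht p))) (by
      rw [hj1, Fintype.sum_prod_type, Finset.sum_comm]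
      refine (Finset.sum_le_sum (g := fun ω => outputLaw W q c ω) fun ω _ => ?_).trans_eq
        (sum_outputLaw W q c)
      change ∑ w, (M : ℝ)⁻¹ * outputLaw W q c ω * (t (w, ω) / 2) ≤ _
      rw [← Finset.mul_sum, ← Finset.sum_div]
      have h1 : (∑ w, t (w, ω)) / 2 ≤ M := by linarith [htsum ω]
      have h2 := mul_le_mul_of_nonneg_left h1
        (mul_nonneg (inv_pos.2 hM).le (outputLaw_nonneg W q c ω))
      refine h2.trans_eq ?_
      field_simp)
  have hpt : ∀ p, j p * Real.logb 2 (j p / ((M : ℝ)⁻¹ * outputLaw W q c p.2 * (t p / 2))) =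
      j p * Real.logb 2 (condLaw W q c p.1 p.2 / outputLaw W q c p.2) + j p
        - j p * (if c.dec p.2.1 = p.1 then 1 else 0) * Real.logb 2 M := by
    intro p
    rcases (hj0 p).eq_or_lt with h | h
    · simp [← h]
    · have h1 := hpos p h
      have h2 := outputLaw_pos W q c h1
      have h3 := ht p
      have e1 : j p / ((M : ℝ)⁻¹ * outputLaw W q c p.2 * (t p / 2)) =
          (condLaw W q c p.1 p.2 / outputLaw W q c p.2) * 2 / t p := by
        simp only [j]
        field_simp
      rw [e1, Real.logb_div (by positivity) h3.ne', Real.logb_mul (by positivity) two_ne_zero,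
        Real.logb_self_eq_one one_lt_two]
      have e2 : Real.logb 2 (t p) = (if c.dec p.2.1 = p.1 then 1 else 0) * Real.logb 2 M := by
        simp only [t]
        split_ifs <;> simp
      rw [e2]
      ring
  simp_rw [hpt] at hg
  rw [Finset.sum_sub_distrib, Finset.sum_add_distrib, hj1, ← Finset.sum_mul] at hg
  have hcorrect : 1 - maxError W q c ≤ ∑ p, j p * (if c.dec p.2.1 = p.1 then 1 else 0) := by
    rw [Fintype.sum_prod_type]
    have : ∀ w, (M : ℝ)⁻¹ * (1 - maxError W q c) ≤
        ∑ ω, j (w, ω) * (if c.dec ω.1 = w then 1 else 0) := by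
      intro w
      have h1 := Pr_error_le_maxError W q c w
      rw [Pr_eq_sum_ite] at h1
      simp only [j, mul_assoc]
      rw [← Finset.mul_sum]
      refine mul_le_mul_of_nonneg_left ?_ (inv_pos.2 hM).le
      have h2 : ∑ ω, condLaw W q c w ω * (if c.dec ω.1 = w then 1 else 0) +
          ∑ ω, condLaw W q c w ω * (if c.dec ω.1 ≠ w then 1 else 0) = 1 := by
        rw [← Finset.sum_add_distrib]
        refine (Finset.sum_congr rfl fun ω _ => ?_).trans (sum_condLaw W q c w)
        by_cases h : c.dec ω.1 = w <;> simp [h]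
      linarith
    refine le_trans (le_of_eq ?_) (Finset.sum_le_sum fun w _ => this w)
    simp
    field_simp
  have hlog : 0 ≤ Real.logb 2 (M : ℝ) := Real.logb_nonneg one_lt_two hM1
  have := mul_le_mul_of_nonneg_right hcorrect hlog
  linarith

/-- The information density of the channel inputs and outputs is at most `n C` on average. -/
theorem sum_logb_chanProb_le [Nonempty X] (W : DMC X Y) (q : FeedbackLink Y Z)
    (c : Code X Y Z n M) :
    ∑ p : Fin M × ((Fin n → Y) × (Fin n → Z)), (M : ℝ)⁻¹ * condLaw W q c p.1 p.2 *
        Real.logb 2 (chanProb W c p.1 p.2 / Pr (outputLaw W q c) {ω' | ω'.1 = p.2.1}) ≤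
      n * maxMutualInfo W := by
  classical
  have := DMC.nonempty_output W
  have hM : (0 : ℝ) < M := Nat.cast_pos.2 c.size_pos
  set μ := outputLaw W q c with hμ
  have hμ0 : ∀ ω, 0 ≤ μ ω := outputLaw_nonneg W q c
  let j : Fin M × ((Fin n → Y) × (Fin n → Z)) → ℝ := fun p => (M : ℝ)⁻¹ * condLaw W q c p.1 p.2
  have hj0 : ∀ p, 0 ≤ j p := fun p => mul_nonneg (inv_pos.2 hM).le (condLaw_nonneg _ _ _ _ _)
  have hj1 : ∑ p, j p = 1 := sum_inv_mul_condLaw W q c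
  have hpos : ∀ p, 0 < j p → 0 < condLaw W q c p.1 p.2 :=
    fun p h => pos_of_mul_pos_right h (inv_pos.2 hM).le
  let inp : Fin n → Fin M × ((Fin n → Y) × (Fin n → Z)) → X :=
    fun i p => c.enc p.1 i (Fin.take i i.isLt.le p.2.2)
  -- The law of the i-th input, averaged over message and feedback; it is the input law to which the
  -- maximality of C is applied.
  let PX : Fin n → X → ℝ := fun i x => ∑ p, j p * if inp i p = x then 1 else 0
  have hPX0 : ∀ i x, 0 ≤ PX i x := fun i x => Finset.sum_nonneg fun p _ =>
    mul_nonneg (hj0 p) (by split_ifs <;> norm_num)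
  have hPXsum : ∀ (i : Fin n) (f : X → ℝ), ∑ x, PX i x * f x = ∑ p, j p * f (inp i p) := by
    intro i f
    simp only [PX, Finset.sum_mul]
    rw [Finset.sum_comm]
    refine Finset.sum_congr rfl fun p _ => ?_
    simp
  have hPX : ∀ i, PX i ∈ stdSimplex ℝ X := by
    refine fun i => ⟨hPX0 i, ?_⟩
    have := hPXsum i fun _ => 1
    simpa [hj1] using this
  let PY : Fin n → Y → ℝ := fun i y => ∑ x, PX i x * W.prob x y
  have hPY0 : ∀ i y, 0 ≤ PY i y := fun i y => Finset.sum_nonneg fun x _ =>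
    mul_nonneg (hPX0 i x) (W.nonneg x y)
  have hPY1 : ∀ i, ∑ y, PY i y = 1 := by
    intro i
    simp only [PY]
    rw [Finset.sum_comm]
    simp only [← Finset.mul_sum, W.sum_eq_one, mul_one]
    exact (hPX i).2
  have hWpos : ∀ p, 0 < j p → ∀ i, 0 < W.prob (inp i p) (p.2.1 i) := by
    intro p h i
    refine (W.nonneg _ _).lt_of_ne' fun h0 => (hpos p h).ne' ?_
    rw [condLaw_eq_chanProb_mul_linkProb, chanProb, Finset.prod_eq_zero (Finset.mem_univ i) h0,
      zero_mul]
  have hPYpos : ∀ p, 0 < j p → ∀ i, 0 < PY i (p.2.1 i) := by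
    intro p h i
    have h1 : 0 < PX i (inp i p) := by
      refine h.trans_le ?_
      have := Finset.single_le_sum (f := fun p' => j p' * if inp i p' = inp i p then (1 : ℝ) else 0)
        (fun p' _ => mul_nonneg (hj0 p') (by split_ifs <;> norm_num)) (Finset.mem_univ p)
      rwa [if_pos rfl, mul_one] at this
    refine (mul_pos h1 (hWpos p h i)).trans_le ?_
    exact Finset.single_le_sum (f := fun x => PX i x * W.prob x (p.2.1 i))
      (fun x _ => mul_nonneg (hPX0 i x) (W.nonneg _ _)) (Finset.mem_univ _)
  have hletter : ∀ i : Fin n,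
      ∑ p, j p * Real.logb 2 (W.prob (inp i p) (p.2.1 i) / PY i (p.2.1 i)) ≤
        maxMutualInfo W := by
    intro i
    refine le_trans (le_of_eq ?_) (mutualInfo_le_max W (hPX i))
    rw [hPXsum i fun x => ∑ y, W.prob x y * Real.logb 2 (W.prob x y / PY i y),
      Fintype.sum_prod_type, Fintype.sum_prod_type]
    refine Finset.sum_congr rfl fun w _ => ?_
    simp only [j, mul_assoc]
    rw [← Finset.mul_sum, ← Finset.mul_sum]
    congr 1
    exact sum_condLaw_input W q c w i fun x y => Real.logb 2 (W.prob x y / PY i y)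
  have hYpos : ∀ p, 0 < j p → 0 < Pr μ {ω' | ω'.1 = p.2.1} :=
    fun p h => Pr_fst_pos hμ0 (outputLaw_pos W q c (hpos p h))
  -- The outputs need not be independent; replacing p(Y^n) by the product of its marginals can only
  -- increase the expected density.
  have hY : 0 ≤ ∑ p, j p * Real.logb 2 (Pr μ {ω' | ω'.1 = p.2.1} / ∏ i, PY i (p.2.1 i)) := by
    have h1 := sum_outputLaw_mul W q c
      fun ω => Real.logb 2 (Pr μ {ω' | ω'.1 = ω.1} / ∏ i, PY i (ω.1 i))
    rw [← hμ] at h1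
    change 0 ≤ ∑ p : Fin M × ((Fin n → Y) × (Fin n → Z)), (M : ℝ)⁻¹ * condLaw W q c p.1 p.2 * _
    rw [← h1, Fintype.sum_prod_type]
    simp only [← Finset.sum_mul, ← Pr_fst_eq]
    refine gibbs (μ := fun y : Fin n → Y => Pr μ {ω' | ω'.1 = y}) (fun y => Pr_nonneg hμ0 _)
      (fun y => Finset.prod_nonneg fun i _ => hPY0 i _) (fun y h => ?_) ?_
    · rw [Pr_fst_eq] at h
      obtain ⟨z, -, hz⟩ := Finset.exists_lt_of_sum_lt
        (s := Finset.univ) (f := fun _ : Fin n → Z => (0 : ℝ)) (g := fun z => μ (y, z))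
        (by simpa using h)
      have hz' : 0 < (M : ℝ)⁻¹ * ∑ w, condLaw W q c w (y, z) := hz
      rw [Finset.mul_sum] at hz'
      obtain ⟨w, -, hw⟩ := Finset.exists_lt_of_sum_lt
        (s := Finset.univ) (f := fun _ : Fin M => (0 : ℝ))
        (g := fun w => (M : ℝ)⁻¹ * condLaw W q c w (y, z)) (by simpa using hz')
      exact Finset.prod_pos fun i _ => hPYpos (w, (y, z)) hw i
    · have h2 : ∑ y : Fin n → Y, ∏ i, PY i (y i) = 1 := by
        rw [← Fintype.prod_sum]
        simp [hPY1]
      have h3 : ∑ y : Fin n → Y, Pr μ {ω' | ω'.1 = y} = 1 := by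
        simp only [Pr_fst_eq]
        rw [← Fintype.sum_prod_type, hμ, sum_outputLaw]
      rw [h2, h3]
  have hpt : ∀ p, j p * Real.logb 2 (chanProb W c p.1 p.2 / Pr μ {ω' | ω'.1 = p.2.1}) =
      ∑ i, j p * Real.logb 2 (W.prob (inp i p) (p.2.1 i) / PY i (p.2.1 i)) -
        j p * Real.logb 2 (Pr μ {ω' | ω'.1 = p.2.1} / ∏ i, PY i (p.2.1 i)) := by
    intro p
    rcases (hj0 p).eq_or_lt with h | h
    · simp [← h]
    · have h1 : chanProb W c p.1 p.2 = ∏ i, W.prob (inp i p) (p.2.1 i) := rfl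
      have h2 : 0 < ∏ i, W.prob (inp i p) (p.2.1 i) := Finset.prod_pos fun i _ => hWpos p h i
      have h3 : 0 < ∏ i, PY i (p.2.1 i) := Finset.prod_pos fun i _ => hPYpos p h i
      rw [← Finset.mul_sum, ← Real.logb_prod _ _
        (fun i _ => (div_pos (hWpos p h i) (hPYpos p h i)).ne'), Finset.prod_div_distrib, h1,
        Real.logb_div h2.ne' (hYpos p h).ne', Real.logb_div h2.ne' h3.ne',
        Real.logb_div (hYpos p h).ne' h3.ne']
      ring
  change ∑ p, j p * _ ≤ _
  simp_rw [hpt]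
  rw [Finset.sum_sub_distrib, Finset.sum_comm]
  have := Finset.sum_le_sum fun (i : Fin n) (_ : i ∈ Finset.univ) => hletter i
  simp only [Finset.sum_const, Finset.card_univ, Fintype.card_fin, nsmul_eq_mul] at this
  linarith

/-- The converse for one block: directed information is lost from the rate. -/
theorem directedInfo_add_le [Nonempty X] (W : DMC X Y) (q : FeedbackLink Y Z)
    (c : Code X Y Z n M) :
    directedInfo (outputLaw W q c) + (1 - maxError W q c) * Real.logb 2 M ≤
      n * maxMutualInfo W + 1 := by
  have := DMC.nonempty_output W
  have hM : (0 : ℝ) < M := Nat.cast_pos.2 c.size_pos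
  have h1 := fano W q c
  have h2 := sum_logb_chanProb_le W q c
  have h3 : directedInfo (outputLaw W q c) + ∑ p : Fin M × ((Fin n → Y) × (Fin n → Z)),
      (M : ℝ)⁻¹ * condLaw W q c p.1 p.2 *
        Real.logb 2 (condLaw W q c p.1 p.2 / outputLaw W q c p.2) =
      ∑ p : Fin M × ((Fin n → Y) × (Fin n → Z)), (M : ℝ)⁻¹ * condLaw W q c p.1 p.2 *
        Real.logb 2 (chanProb W c p.1 p.2 / Pr (outputLaw W q c) {ω' | ω'.1 = p.2.1}) := by
    rw [directedInfo, sum_outputLaw_mul W q c fun ω => Real.logb 2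
      (causalCondProb (outputLaw W q c) ω.1 ω.2 / Pr (outputLaw W q c) {ω' | ω'.1 = ω.1}),
      ← Finset.sum_add_distrib]
    refine Finset.sum_congr rfl fun p _ => ?_
    rcases (condLaw_nonneg W q c p.1 p.2).eq_or_lt with h | h
    · simp [← h]
    · have hμ := outputLaw_pos W q c h
      have hP := Pr_fst_pos (outputLaw_nonneg W q c) hμ
      have hccp := causalCondProb_mul_linkProb W q c hμ
      have hl : 0 < linkProb q p.2 := by
        refine (linkProb_nonneg q p.2).lt_of_ne' fun h0 => hμ.ne' ?_
        rw [← hccp, h0, mul_zero]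
      have hc : 0 < causalCondProb (outputLaw W q c) p.2.1 p.2.2 :=
        pos_of_mul_pos_left (hccp ▸ hμ) hl.le
      have hch := condLaw_eq_chanProb_mul_linkProb W q c p.1 p.2
      have hch0 : 0 < chanProb W c p.1 p.2 := pos_of_mul_pos_left (hch ▸ h) hl.le
      -- The cancellation of the link factor.
      have e : condLaw W q c p.1 p.2 / outputLaw W q c p.2 =
          chanProb W c p.1 p.2 / causalCondProb (outputLaw W q c) p.2.1 p.2.2 := by
        conv_lhs => rw [← hccp, hch]
        rw [mul_div_mul_right _ _ hl.ne']
      rw [e, Real.logb_div hc.ne' hP.ne', Real.logb_div hch0.ne' hc.ne',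
        Real.logb_div hch0.ne' hP.ne']
      ring
  linarith

end Converse

/-! ### Feinstein's greedy code construction -/

/-- Feinstein's lemma: greedily chosen codewords with disjoint decoding sets. -/
theorem feinstein {A B : Type*} [Fintype A] [Fintype B] (V : Transition A B) {p : A → ℝ}
    (hp : p ∈ stdSimplex ℝ A) {γ ε : ℝ} (hγ : 0 < γ) {M : ℕ}
    (hε : ∑ a, p a * Pr (V.prob a) {b | V.prob a b ≤ γ * ∑ a', p a' * V.prob a' b} + M / γ ≤ ε)
    {k : ℕ} (hk : k ≤ M) :
    ∃ (x : Fin k → A) (D : Fin k → Set B), (∀ i j, i ≠ j → Disjoint (D i) (D j)) ∧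
      (∀ i, ∀ b ∈ D i, γ * ∑ a', p a' * V.prob a' b < V.prob (x i) b) ∧
      ∀ i, 1 - ε ≤ Pr (V.prob (x i)) (D i) := by
  classical
  induction k with
  | zero => exact ⟨Fin.elim0, Fin.elim0, fun i => i.elim0, fun i => i.elim0, fun i => i.elim0⟩
  | succ k ih =>
    obtain ⟨x, D, hdisj, hD, hV⟩ := ih (k.le_succ.trans hk)
    let r : B → ℝ := fun b => ∑ a', p a' * V.prob a' b
    let U : Set B := ⋃ i, D i
    have hone : ∀ a, ∑ b, V.prob a b = 1 := V.sum_eq_one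
    -- The next decoding set consists of the unused outputs of high density. If no input gave it
    -- mass 1 - ε, averaging over p would yield 1 < (1 - ε) + P(low density) + k/γ, against `hε`.
    suffices h : ∃ a, 1 - ε ≤ Pr (V.prob a) {b | γ * r b < V.prob a b ∧ b ∉ U} by
      obtain ⟨a, ha⟩ := h
      refine ⟨Fin.snoc x a, Fin.snoc D {b | γ * r b < V.prob a b ∧ b ∉ U}, ?_, ?_, ?_⟩
      · intro i j
        refine Fin.lastCases ?_ (fun i => ?_) i <;> refine Fin.lastCases ?_ (fun j => ?_) j
        · exact fun h => absurd rfl h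
        · intro _
          rw [Fin.snoc_last, Fin.snoc_castSucc, Set.disjoint_left]
          exact fun b hb hb' => hb.2 (Set.mem_iUnion_of_mem j hb')
        · intro _
          rw [Fin.snoc_last, Fin.snoc_castSucc, Set.disjoint_left]
          exact fun b hb' hb => hb.2 (Set.mem_iUnion_of_mem i hb')
        · intro h
          rw [Fin.snoc_castSucc, Fin.snoc_castSucc]
          exact hdisj i j fun e => h (e ▸ rfl)
      · intro i
        refine Fin.lastCases ?_ (fun i => ?_) i
        · rw [Fin.snoc_last, Fin.snoc_last]
          exact fun b hb => hb.1
        · rw [Fin.snoc_castSucc, Fin.snoc_castSucc]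
          exact hD i
      · intro i
        refine Fin.lastCases ?_ (fun i => ?_) i
        · rw [Fin.snoc_last, Fin.snoc_last]
          exact ha
        · rw [Fin.snoc_castSucc, Fin.snoc_castSucc]
          exact hV i
    by_contra! hcon
    -- the output mass of the union of the decoding sets is small
    have hU : ∑ b, r b * (if b ∈ U then 1 else 0) ≤ k / γ := by
      have h1 : ∀ b, r b * (if b ∈ U then 1 else 0) ≤
          ∑ i, V.prob (x i) b / γ := by
        intro b
        have h0 : ∀ i, 0 ≤ V.prob (x i) b / γ := fun i => div_nonneg (V.nonneg _ _) hγ.le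
        by_cases hb : b ∈ U
        · obtain ⟨i, hi⟩ := Set.mem_iUnion.1 hb
          rw [if_pos hb, mul_one]
          refine le_trans ?_ (Finset.single_le_sum (fun i _ => h0 i) (Finset.mem_univ i))
          rw [le_div_iff₀ hγ, mul_comm]
          exact (hD i b hi).le
        · rw [if_neg hb, mul_zero]
          exact Finset.sum_nonneg fun i _ => h0 i
      refine (Finset.sum_le_sum fun b _ => h1 b).trans_eq ?_
      rw [Finset.sum_comm]
      simp only [← Finset.sum_div, hone]
      simp [div_eq_mul_inv]
    have hsplit : ∀ a, 1 ≤ Pr (V.prob a) {b | γ * r b < V.prob a b ∧ b ∉ U} +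
        Pr (V.prob a) {b | V.prob a b ≤ γ * r b} +
        ∑ b, V.prob a b * (if b ∈ U then 1 else 0) := by
      intro a
      rw [Pr_eq_sum_ite, Pr_eq_sum_ite, ← Finset.sum_add_distrib, ← Finset.sum_add_distrib]
      refine (hone a).symm.trans_le (Finset.sum_le_sum fun b _ => ?_)
      have := V.nonneg a b
      rcases lt_or_ge (γ * r b) (V.prob a b) with h1 | h1 <;> by_cases h2 : b ∈ U
      · simp [h1, h1.not_ge, h2]
      · simp [h1, h1.not_ge, h2]
      · simp [h1, h1.not_gt, h2, this]
      · simp [h1, h1.not_gt, h2]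
    have hsum : ∑ a, p a * (Pr (V.prob a) {b | γ * r b < V.prob a b ∧ b ∉ U} +
        Pr (V.prob a) {b | V.prob a b ≤ γ * r b} +
        ∑ b, V.prob a b * (if b ∈ U then 1 else 0)) ≥ 1 := by
      refine hp.2.symm.trans_le (Finset.sum_le_sum fun a _ => ?_)
      exact le_mul_of_one_le_right (hp.1 a) (hsplit a)
    have e3 : ∑ a, p a * ∑ b, V.prob a b * (if b ∈ U then (1 : ℝ) else 0) =
        ∑ b, r b * (if b ∈ U then 1 else 0) := by
      simp only [r, Finset.mul_sum, Finset.sum_mul, mul_assoc]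
      exact Finset.sum_comm
    have e1 : ∑ a, p a * Pr (V.prob a) {b | γ * r b < V.prob a b ∧ b ∉ U} < 1 - ε := by
      have hex : ∃ a, 0 < p a := by
        by_contra! h
        have := Finset.sum_nonpos fun a (_ : a ∈ Finset.univ) => h a
        rw [hp.2] at this
        linarith
      obtain ⟨a0, ha0⟩ := hex
      have : ∑ a, p a * Pr (V.prob a) {b | γ * r b < V.prob a b ∧ b ∉ U} <
          ∑ a, p a * (1 - ε) :=
        Finset.sum_lt_sum (fun a _ => mul_le_mul_of_nonneg_left (hcon a).le (hp.1 a))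
          ⟨a0, Finset.mem_univ _, mul_lt_mul_of_pos_left (hcon a0) ha0⟩
      rwa [← Finset.sum_mul, hp.2, one_mul] at this
    simp only [mul_add, Finset.sum_add_distrib] at hsum
    rw [e3] at hsum
    have hkM : (k : ℝ) / γ ≤ M / γ :=
      div_le_div_of_nonneg_right (Nat.cast_le.2 (k.le_succ.trans hk)) hγ.le
    linarith

/-! ### The weak law of large numbers -/

section LargeNumbers

variable {Ω : Type*} [Fintype Ω]

theorem sum_prod_eq_one {p : Ω → ℝ} (hp : ∑ ω, p ω = 1) (n : ℕ) :
    ∑ a : Fin n → Ω, ∏ i, p (a i) = 1 := by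
  rw [← Fintype.prod_sum (fun (_ : Fin n) ω => p ω)]
  simp [hp]

/-- The variance of a sum of independent centred random variables. -/
theorem sum_prod_mul_sum_sq {p f : Ω → ℝ} (hp : ∑ ω, p ω = 1) (hf : ∑ ω, p ω * f ω = 0)
    (n : ℕ) : ∑ a : Fin n → Ω, (∏ i, p (a i)) * (∑ i, f (a i)) ^ 2 =
      n * ∑ ω, p ω * f ω ^ 2 := by
  induction n with
  | zero => simp
  | succ n ih =>
    rw [sum_snoc]
    simp only [Fin.prod_univ_castSucc, Fin.sum_univ_castSucc, Fin.snoc_castSucc, Fin.snoc_last]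
    have : ∀ a : Fin n → Ω, ∑ x, (∏ i, p (a i)) * p x * (∑ i, f (a i) + f x) ^ 2 =
        (∏ i, p (a i)) * (∑ i, f (a i)) ^ 2 + (∏ i, p (a i)) * ∑ ω, p ω * f ω ^ 2 := by
      intro a
      have : ∀ x, (∏ i, p (a i)) * p x * (∑ i, f (a i) + f x) ^ 2 =
        p x * ((∏ i, p (a i)) * (∑ i, f (a i)) ^ 2) +
          2 * ((∏ i, p (a i)) * ∑ i, f (a i)) * (p x * f x) +
          (∏ i, p (a i)) * (p x * f x ^ 2) := fun x => by ring
      simp only [this, Finset.sum_add_distrib]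
      rw [← Finset.sum_mul, ← Finset.mul_sum, ← Finset.mul_sum, hp, hf]
      ring
    simp only [this, Finset.sum_add_distrib, ih]
    rw [← Finset.sum_mul, sum_prod_eq_one hp]
    push_cast
    ring

/-- Chebyshev's inequality for the lower tail of a sum of independent random variables. -/
theorem chebyshev_lower {p f : Ω → ℝ} (hp : p ∈ stdSimplex ℝ Ω) {n : ℕ} (hn : 0 < n) {δ : ℝ}
    (hδ : 0 < δ) :
    Pr (fun a : Fin n → Ω => ∏ i, p (a i)) {a | ∑ i, f (a i) ≤ n * (∑ ω, p ω * f ω - δ)} ≤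
      (∑ ω, p ω * (f ω - ∑ ω', p ω' * f ω') ^ 2) / δ ^ 2 / n := by
  classical
  set m := ∑ ω, p ω * f ω with hm
  have hn' : (0 : ℝ) < n := Nat.cast_pos.2 hn
  have hcent : ∑ ω, p ω * (f ω - m) = 0 := by
    simp only [mul_sub, Finset.sum_sub_distrib, ← Finset.sum_mul, hp.2]
    rw [← hm]
    ring
  have hvar := sum_prod_mul_sum_sq hp.2 hcent n
  rw [Pr_eq_sum_ite]
  have hpt : ∀ a : Fin n → Ω, (∏ i, p (a i)) *
      (if ∑ i, f (a i) ≤ n * (m - δ) then 1 else 0) ≤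
        (∏ i, p (a i)) * (∑ i, (f (a i) - m)) ^ 2 / (n * δ) ^ 2 := by
    intro a
    rw [mul_div_assoc]
    refine mul_le_mul_of_nonneg_left ?_ (Finset.prod_nonneg fun i _ => hp.1 _)
    split_ifs with h
    · rw [le_div_iff₀ (by positivity), one_mul]
      have : ∑ i, (f (a i) - m) ≤ -(n * δ) := by
        rw [Finset.sum_sub_distrib]
        simp only [Finset.sum_const, Finset.card_univ, Fintype.card_fin, nsmul_eq_mul]
        linarith
      have h0 : 0 < n * δ := by positivity
      nlinarith
    · positivity
  refine (Finset.sum_le_sum fun a _ => hpt a).trans_eq ?_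
  rw [← Finset.sum_div, hvar]
  field_simp

end LargeNumbers

/-! ### Open-loop codes at every rate below C -/

section Achievability

variable {X Y Z : Type*} [Fintype X] [Fintype Y] [Fintype Z]

/-- The memoryless extension of a channel to blocks. -/
def blockChannel (W : DMC X Y) (n : ℕ) : Transition (Fin n → X) (Fin n → Y) where
  prob x y := ∏ i, W.prob (x i) (y i)
  nonneg x y := Finset.prod_nonneg fun i _ => W.nonneg _ _
  sum_eq_one x := by
    rw [← Fintype.prod_sum fun i y => W.prob (x i) y]
    simp [W.sum_eq_one]

/-- The open-loop code with given codewords and decoder. -/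
def openLoopCode {n M : ℕ} (x : Fin M → Fin n → X) (d : (Fin n → Y) → Fin M) :
    Code X Y Z n M := ⟨fun w i _ => x w i, d⟩

theorem Pr_condLaw_openLoopCode [Nonempty Y] (W : DMC X Y) (q : FeedbackLink Y Z) {n M : ℕ}
    (x : Fin M → Fin n → X) (d : (Fin n → Y) → Fin M) (w : Fin M) (E : Set (Fin n → Y)) :
    Pr (condLaw W q (openLoopCode x d) w) {ω | ω.1 ∈ E} =
      Pr ((blockChannel W n).prob (x w)) E := by
  classical
  rw [Pr_eq_sum_ite, Fintype.sum_prod_type]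
  refine Eq.trans ?_ (Pr_eq_sum_ite _ (· ∈ E)).symm
  refine Finset.sum_congr rfl fun y _ => ?_
  have : ∀ z : Fin n → Z, chanProb W (openLoopCode (Z := Z) x d) w (y, z) =
    (blockChannel W n).prob (x w) y := fun z => rfl
  by_cases h : y ∈ E
  · simp only [condLaw_eq_chanProb_mul_linkProb, this, h, if_true, mul_one, ← Finset.mul_sum,
      sum_linkProb]
  · simp [h]

theorem Pr_mono {Ω : Type*} [Fintype Ω] {μ : Ω → ℝ} (hμ : ∀ ω, 0 ≤ μ ω) {E F : Set Ω}
    (h : E ⊆ F) : Pr μ E ≤ Pr μ F :=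
  Finset.sum_le_sum fun ω _ => Set.indicator_le_indicator_of_subset h hμ ω

theorem Pr_compl {Ω : Type*} [Fintype Ω] {μ : Ω → ℝ} (hμ : ∑ ω, μ ω = 1) (E : Set Ω) :
    Pr μ Eᶜ = 1 - Pr μ E := by
  rw [eq_sub_iff_add_eq, ← hμ]
  unfold Pr
  rw [← Finset.sum_add_distrib]
  exact Finset.sum_congr rfl fun ω _ => congrFun (Set.indicator_compl_add_self E μ) ω

/-- Under the input law `p`, the density of a random block is large with high probability. -/
theorem sum_Pr_blockChannel_le (W : DMC X Y) {p : X → ℝ} (hp : p ∈ stdSimplex ℝ X) {δ : ℝ}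
    (hδ : 0 < δ) : ∃ K : ℝ, ∀ n : ℕ, 0 < n →
      ∑ x : Fin n → X, (∏ i, p (x i)) * Pr ((blockChannel W n).prob x)
        {y | (blockChannel W n).prob x y ≤
          (2 : ℝ) ^ (n * (mutualInfo (fun ω : X × Y => p ω.1 * W.prob ω.1 ω.2) - δ)) *
            ∑ x' : Fin n → X, (∏ i, p (x' i)) * (blockChannel W n).prob x' y} ≤ K / n := by
  classical
  let P : X × Y → ℝ := fun ω => p ω.1 * W.prob ω.1 ω.2
  let r : Y → ℝ := fun y => ∑ a, p a * W.prob a y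
  let f : X × Y → ℝ := fun ω => Real.logb 2 (W.prob ω.1 ω.2 / r ω.2)
  have hP : P ∈ stdSimplex ℝ (X × Y) := by
    refine ⟨fun ω => mul_nonneg (hp.1 _) (W.nonneg _ _), ?_⟩
    rw [Fintype.sum_prod_type]
    simp only [P, ← Finset.mul_sum, W.sum_eq_one, mul_one]
    exact hp.2
  have hI : mutualInfo (fun ω : X × Y => p ω.1 * W.prob ω.1 ω.2) = ∑ ω, P ω * f ω := by
    rw [mutualInfo_channel W hp.1, Fintype.sum_prod_type]
    simp only [P, f, r, Finset.mul_sum, mul_assoc]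
  refine ⟨(∑ ω, P ω * (f ω - ∑ ω', P ω' * f ω') ^ 2) / δ ^ 2, fun n hn => ?_⟩
  refine le_trans ?_ (chebyshev_lower hP hn hδ)
  rw [hI]
  set m := ∑ ω, P ω * f ω
  rw [Pr_eq_sum_ite,
    ← (Equiv.arrowProdEquivProdArrow (Fin n) (fun _ => X) fun _ => Y).symm.sum_comp,
    Fintype.sum_prod_type]
  refine Finset.sum_le_sum fun (x : Fin n → X) _ => ?_
  rw [Pr_eq_sum_ite, Finset.mul_sum]
  refine Finset.sum_le_sum fun (y : Fin n → Y) _ => ?_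
  have hr : ∑ x' : Fin n → X, (∏ i, p (x' i)) * (blockChannel W n).prob x' y = ∏ i, r (y i) := by
    rw [Fintype.prod_sum]
    simp only [blockChannel, Finset.prod_mul_distrib]
  rw [hr]
  change (∏ i, p (x i)) * ((∏ i, W.prob (x i) (y i)) *
    if ∏ i, W.prob (x i) (y i) ≤ _ then 1 else 0) ≤ (∏ i, p (x i) * W.prob (x i) (y i)) *
      if ∑ i, f (x i, y i) ≤ n * (m - δ) then 1 else 0
  rw [← mul_assoc, ← Finset.prod_mul_distrib]
  have h0 : 0 ≤ ∏ i, p (x i) * W.prob (x i) (y i) :=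
    Finset.prod_nonneg fun i _ => mul_nonneg (hp.1 _) (W.nonneg _ _)
  rcases h0.eq_or_lt with h | h
  -- Pairs of blocks of weight zero contribute nothing; elsewhere all factors are positive and the
  -- logarithm turns the density into a sum over letters.
  · rw [← h]; simp
  · refine mul_le_mul_of_nonneg_left ?_ h0
    have hne := Finset.prod_ne_zero_iff.1 h.ne'
    have hW : ∀ i, 0 < W.prob (x i) (y i) := fun i =>
      (W.nonneg _ _).lt_of_ne' (right_ne_zero_of_mul (hne i (Finset.mem_univ i)))
    have hpx : ∀ i, 0 < p (x i) := fun i =>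
      (hp.1 _).lt_of_ne' (left_ne_zero_of_mul (hne i (Finset.mem_univ i)))
    have hr0 : ∀ i, 0 < r (y i) := fun i => (mul_pos (hpx i) (hW i)).trans_le
      (Finset.single_le_sum (f := fun a => p a * W.prob a (y i))
        (fun a _ => mul_nonneg (hp.1 a) (W.nonneg _ _)) (Finset.mem_univ _))
    split_ifs with h1 h2 <;> norm_num
    refine h2 ?_
    rw [← div_le_iff₀ (Finset.prod_pos fun i _ => hr0 i), ← Finset.prod_div_distrib,
      ← Real.logb_le_iff_le_rpow one_lt_two
        (Finset.prod_pos fun i _ => div_pos (hW i) (hr0 i)),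
      Real.logb_prod _ _ fun i _ => (div_pos (hW i) (hr0 i)).ne'] at h1
    exact h1

theorem exists_openLoop_code [Nonempty X] (W : DMC X Y) (q : FeedbackLink Y Z) {n M : ℕ}
    (hM : 0 < M) {p : X → ℝ} (hp : p ∈ stdSimplex ℝ X) {γ ε : ℝ} (hγ : 0 < γ)
    (hε : ∑ x : Fin n → X, (∏ i, p (x i)) * Pr ((blockChannel W n).prob x)
        {y | (blockChannel W n).prob x y ≤
          γ * ∑ x' : Fin n → X, (∏ i, p (x' i)) * (blockChannel W n).prob x' y} + M / γ ≤ ε) :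
    ∃ c : Code X Y Z n M, c.IsOpenLoop ∧ maxError W q c ≤ ε := by
  classical
  have := DMC.nonempty_output W
  have : Nonempty (Fin M) := ⟨⟨0, hM⟩⟩
  have hpn : (fun x : Fin n → X => ∏ i, p (x i)) ∈ stdSimplex ℝ (Fin n → X) :=
    ⟨fun x => Finset.prod_nonneg fun i _ => hp.1 _, sum_prod_eq_one hp.2 n⟩
  obtain ⟨x, D, hdisj, -, hV⟩ := feinstein (blockChannel W n) hpn hγ hε le_rfl
  -- Outputs outside all decoding sets are decoded arbitrarily; they are already counted as errors.
  let d : (Fin n → Y) → Fin M := fun y =>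
    if h : ∃ w, y ∈ D w then h.choose else Classical.arbitrary _
  have hd : ∀ w, ∀ y ∈ D w, d y = w := by
    intro w y hy
    have h : ∃ w, y ∈ D w := ⟨w, hy⟩
    simp only [d, dif_pos h]
    by_contra hne
    exact Set.disjoint_left.1 (hdisj _ _ hne) h.choose_spec hy
  refine ⟨openLoopCode x d, fun _ _ _ _ => rfl, ciSup_le fun w => ?_⟩
  refine (Pr_condLaw_openLoopCode W q x d w {y | d y ≠ w}).trans_le ?_
  have h1 : Pr ((blockChannel W n).prob (x w)) {y | d y ≠ w} ≤
      Pr ((blockChannel W n).prob (x w)) (D w)ᶜ :=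
    Pr_mono ((blockChannel W n).nonneg _) fun y hy hy' => hy (hd w y hy')
  rw [Pr_compl ((blockChannel W n).sum_eq_one _)] at h1
  linarith [hV w]

theorem maxError_nonneg (W : DMC X Y) (q : FeedbackLink Y Z) {n M : ℕ} (c : Code X Y Z n M) :
    0 ≤ maxError W q c :=
  Real.iSup_nonneg fun w => Pr_nonneg (condLaw_nonneg W q c w) _

theorem mem_openLoopRates_of_lt [Nonempty X] (W : DMC X Y) (q : FeedbackLink Y Z) {R : ℝ}
    (hR0 : 0 ≤ R) (hR : R < maxMutualInfo W) : R ∈ openLoopRates W q := by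
  have hY := DMC.nonempty_output W
  obtain ⟨p, hp, hpI⟩ := (isGreatest_maxMutualInfo W).1
  simp only at hpI
  -- Half the gap: the threshold 2^(n(C-δ)) exceeds the number of messages by a factor at least
  -- 2^(nδ), and the density falls below it with probability O(1/n).
  set δ := (maxMutualInfo W - R) / 2 with hδdef
  have hδ : 0 < δ := by linarith
  obtain ⟨K, hK⟩ := sum_Pr_blockChannel_le W hp hδ
  rw [hpI] at hK
  have hex : ∀ n : ℕ, ∃ c : Code X Y Z n (2 ^ ⌊(n : ℝ) * R⌋₊), c.IsOpenLoop ∧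
      (0 < n → maxError W q c ≤ K / n + ((2 : ℝ) ^ (-δ)) ^ n) := by
    intro n
    rcases Nat.eq_zero_or_pos n with rfl | hn
    · exact ⟨openLoopCode (fun _ _ => Classical.arbitrary X) fun _ => ⟨0, by positivity⟩,
        fun _ _ _ _ => rfl, fun h => absurd h (lt_irrefl _)⟩
    · obtain ⟨c, hc, hc'⟩ := exists_openLoop_code (Z := Z) W q
        (n := n) (M := 2 ^ ⌊(n : ℝ) * R⌋₊) (by positivity) hp
        (γ := (2 : ℝ) ^ (n * (maxMutualInfo W - δ)))
        (ε := K / n + ((2 : ℝ) ^ (-δ)) ^ n) (by positivity) (by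
          refine add_le_add (hK n hn) ?_
          rw [← Real.rpow_natCast ((2 : ℝ) ^ (-δ)), ← Real.rpow_mul zero_le_two]
          push_cast
          rw [← Real.rpow_natCast 2, ← Real.rpow_sub two_pos]
          refine Real.rpow_le_rpow_of_exponent_le one_le_two ?_
          have := Nat.floor_le (show 0 ≤ (n : ℝ) * R by positivity)
          have h2 : maxMutualInfo W = R + 2 * δ := by rw [hδdef]; ring
          rw [h2]
          linarith)
      exact ⟨c, hc, fun _ => hc'⟩
  choose c hc hc' using hex
  refine ⟨hR0, ⟨fun n => 2 ^ ⌊(n : ℝ) * R⌋₊, c⟩, fun n => rfl, hc, ?_⟩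
  have hlim : Tendsto (fun n : ℕ => K / n + ((2 : ℝ) ^ (-δ)) ^ n) atTop (𝓝 0) := by
    have h1 := tendsto_const_div_atTop_nhds_zero_nat K
    have h2 := tendsto_pow_atTop_nhds_zero_of_lt_one (r := (2 : ℝ) ^ (-δ)) (by positivity)
      (Real.rpow_lt_one_of_one_lt_of_neg one_lt_two (by linarith))
    simpa using h1.add h2
  refine tendsto_of_tendsto_of_tendsto_of_le_of_le' tendsto_const_nhds hlim
    (Eventually.of_forall fun n => maxError_nonneg W q (c n)) ?_
  filter_upwards [eventually_gt_atTop 0] with n hn using hc' n hn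

/-- Needed separately: if C = 0, no nonnegative rate lies below C. It also shows that upper bounds
of the rates are nonnegative. -/
theorem zero_mem_openLoopRates [Nonempty X] (W : DMC X Y) (q : FeedbackLink Y Z) :
    (0 : ℝ) ∈ openLoopRates W q := by
  refine ⟨le_rfl, ⟨fun n => 2 ^ ⌊(n : ℝ) * 0⌋₊, fun n => openLoopCode
    (fun _ _ => Classical.arbitrary X) fun _ => ⟨0, by positivity⟩⟩, fun n => rfl,
    fun n _ _ _ _ => rfl, ?_⟩
  refine tendsto_const_nhds.congr fun n => ?_
  have h1 : 2 ^ ⌊(n : ℝ) * 0⌋₊ = 1 := by simp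
  have hs : Subsingleton (Fin (2 ^ ⌊(n : ℝ) * 0⌋₊)) := by rw [h1]; infer_instance
  symm
  refine (congrArg iSup (funext fun w => ?_)).trans (Real.iSup_const_zero)
  have : ∀ a b : Fin (2 ^ ⌊(n : ℝ) * 0⌋₊), a = b := fun a b => Subsingleton.elim a b
  have he : {ω : (Fin n → Y) × (Fin n → Z) | (⟨0, by positivity⟩ : Fin (2 ^ ⌊(n : ℝ) * 0⌋₊)) ≠ w}
      = ∅ := by
    ext ω
    simp [this _ w]
  refine (congrArg (Pr _) he).trans ?_
  simp [Pr]

end Achievability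

/-! ### Capacities and the rate loss -/

section Capacity

variable {X Y Z : Type*} [Fintype X] [Fintype Y] [Fintype Z]

/-- An eventual lower bound L replaces the liminf so that one limit argument serves twice: L = 0
gives the capacity converse, L close to the liminf gives the rate loss. -/
theorem rate_le_of_eventually [Nonempty X] (W : DMC X Y) (q : FeedbackLink Y Z)
    {c : CodeSeq X Y Z} {R L : ℝ} (hc : c.Reliable W q) (hR : c.AttainsRate R)
    (hL : ∀ᶠ n : ℕ in atTop, L ≤ directedInfo (outputLaw W q (c.code n)) / n) :
    R ≤ maxMutualInfo W - L := by
  refine le_of_forall_pos_le_add fun ε hε => ?_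
  have hlhs : Tendsto (fun n => (1 - maxError W q (c.code n)) * (R - ε)) atTop
      (𝓝 ((1 - 0) * (R - ε))) := (tendsto_const_nhds.sub hc).mul tendsto_const_nhds
  have hrhs : Tendsto (fun n : ℕ => maxMutualInfo W + 1 / (n : ℝ) - L) atTop
      (𝓝 (maxMutualInfo W + 0 - L)) :=
    (tendsto_const_nhds.add (tendsto_const_div_atTop_nhds_zero_nat 1)).sub tendsto_const_nhds
  -- Ensures 1 - error ≥ 0, so that the lower bound on the rate may be multiplied by it.
  have hsmall : ∀ᶠ n in atTop, maxError W q (c.code n) ≤ 1 :=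
    (hc.eventually (gt_mem_nhds zero_lt_one)).mono fun n h => h.le
  have := le_of_tendsto_of_tendsto hlhs hrhs (by
    filter_upwards [hL, hR ε hε, hsmall, eventually_gt_atTop 0] with n h1 h2 h3 h4
    have hn : (0 : ℝ) < n := Nat.cast_pos.2 h4
    have h5 := directedInfo_add_le W q (c.code n)
    have h6 := mul_le_mul_of_nonneg_left h2 (sub_nonneg.2 h3)
    refine h6.trans ?_
    rw [le_div_iff₀ hn] at h1
    rw [← mul_div_assoc, div_le_iff₀ hn, sub_mul _ L, add_mul, div_mul_cancel₀ _ hn.ne']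
    linarith)
  linarith

theorem attainsRate_of_size (c : CodeSeq X Y Z) {R : ℝ}
    (hsize : ∀ n : ℕ, c.size n = 2 ^ ⌊(n : ℝ) * R⌋₊) : c.AttainsRate R := by
  intro ε hε
  have h := (tendsto_const_div_atTop_nhds_zero_nat (1 : ℝ)).eventually (gt_mem_nhds hε)
  filter_upwards [h, eventually_gt_atTop 0] with n h1 h2
  have hn : (0 : ℝ) < n := Nat.cast_pos.2 h2
  have h3 := Nat.lt_floor_add_one ((n : ℝ) * R)
  rw [div_lt_iff₀ hn] at h1
  rw [hsize, le_div_iff₀ hn]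
  push_cast
  rw [Real.logb_pow, Real.logb_self_eq_one one_lt_two]
  linarith

theorem feedbackRates_le [Nonempty X] (W : DMC X Y) (q : FeedbackLink Y Z) :
    maxMutualInfo W ∈ upperBounds (feedbackRates W q) := by
  rintro R ⟨-, c, hsize, hc⟩
  have := rate_le_of_eventually W q (L := 0) hc (attainsRate_of_size c hsize)
    (Eventually.of_forall fun n => div_nonneg (directedInfo_nonneg W q _) n.cast_nonneg)
  simpa using this

theorem openLoopRates_subset (W : DMC X Y) (q : FeedbackLink Y Z) :
    openLoopRates W q ⊆ feedbackRates W q := by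
  rintro R ⟨h0, c, hsize, -, hc⟩
  exact ⟨h0, c, hsize, hc⟩

theorem isLUB_openLoopRates [Nonempty X] (W : DMC X Y) (q : FeedbackLink Y Z) :
    IsLUB (openLoopRates W q) (maxMutualInfo W) := by
  refine ⟨fun R hR => feedbackRates_le W q (openLoopRates_subset W q hR), fun b hb => ?_⟩
  have hb0 := hb (zero_mem_openLoopRates W q)
  by_contra! h
  obtain ⟨R, h1, h2⟩ := exists_between h
  exact h1.not_ge (hb (mem_openLoopRates_of_lt W q (hb0.trans h1.le) h2))

theorem isLUB_feedbackRates [Nonempty X] (W : DMC X Y) (q : FeedbackLink Y Z) :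
    IsLUB (feedbackRates W q) (maxMutualInfo W) :=
  ⟨feedbackRates_le W q, fun _ hb =>
    (isLUB_openLoopRates W q).2 fun _ hR => hb (openLoopRates_subset W q hR)⟩

/-- The rate loss caused by the directed information from the feedback link. -/
theorem rate_le_sub_directedInfoRate [Nonempty X] (W : DMC X Y) (q : FeedbackLink Y Z)
    (c : CodeSeq X Y Z) (R : ℝ) (hc : c.Reliable W q) (ht : c.IsTypicalClosedLoop W q)
    (hR : c.AttainsRate R) : R ≤ maxMutualInfo W - c.directedInfoRate W q := by
  refine le_of_forall_pos_le_add fun ε hε => ?_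
  -- The real liminf is the supremum of the eventual lower bounds, with value 0 when there are none;
  -- being positive, it is a supremum over a nonempty set and can be approached from below.
  have hpos : 0 < liminf (fun n : ℕ => directedInfo (outputLaw W q (c.code n)) / n) atTop := ht
  rw [liminf_eq] at hpos
  have hne : {a : ℝ | ∀ᶠ n : ℕ in atTop,
      a ≤ directedInfo (outputLaw W q (c.code n)) / n}.Nonempty :=
    Set.nonempty_iff_ne_empty.2 fun h => by rw [h, Real.sSup_empty] at hpos; exact lt_irrefl _ hpos
  have hlt : c.directedInfoRate W q - ε < c.directedInfoRate W q := by linarith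
  nth_rewrite 2 [CodeSeq.directedInfoRate] at hlt
  rw [liminf_eq] at hlt
  obtain ⟨L, hL, hLlt⟩ := exists_lt_of_lt_csSup hne hlt
  have := rate_le_of_eventually W q hc hR hL
  linarith

end Capacity

end NoisyFeedback

end

theorem theorem2 {X Y Z : Type*} [Fintype X] [Fintype Y] [Fintype Z] [Nonempty X]
    (W : NoisyFeedback.DMC X Y) (q : NoisyFeedback.FeedbackLink Y Z) :
    -- `C` is a maximum, and both operational capacities (suprema of achievable rates) equal `C`
    IsGreatest (NoisyFeedback.mutualInfoValues W) (NoisyFeedback.maxMutualInfo W) ∧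
    IsLUB (NoisyFeedback.openLoopRates W q) (NoisyFeedback.maxMutualInfo W) ∧
    IsLUB (NoisyFeedback.feedbackRates W q) (NoisyFeedback.maxMutualInfo W) ∧
    -- no typical closed-loop encoder achieves the capacity
    (∀ c : NoisyFeedback.CodeSeq X Y Z, c.Reliable W q → c.IsTypicalClosedLoop W q →
      ¬ c.AttainsRate (NoisyFeedback.maxMutualInfo W)) ∧
    -- every capacity-achieving encoder is non-typical
    (∀ c : NoisyFeedback.CodeSeq X Y Z, c.Reliable W q →
      c.AttainsRate (NoisyFeedback.maxMutualInfo W) → ¬ c.IsTypicalClosedLoop W q) ∧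
    -- the rate loss of a typical closed-loop encoder
    (∀ (c : NoisyFeedback.CodeSeq X Y Z) (R : ℝ), c.Reliable W q → c.IsTypicalClosedLoop W q →
      c.AttainsRate R → R ≤ NoisyFeedback.maxMutualInfo W - c.directedInfoRate W q) := by
  refine ⟨NoisyFeedback.isGreatest_maxMutualInfo W, NoisyFeedback.isLUB_openLoopRates W q,
    NoisyFeedback.isLUB_feedbackRates W q, fun c hc ht hR => ?_, fun c hc hR ht => ?_,
    NoisyFeedback.rate_le_sub_directedInfoRate W q⟩ <;>
  -- Both forms of the exclusion are the rate loss at R = C.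
  · have h := NoisyFeedback.rate_le_sub_directedInfoRate W q c _ hc ht hR
    have h' : 0 < c.directedInfoRate W q := ht
    linarith
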